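/- Let $n\ge 1$, $p\ge 2$, $x\in\{\pm1\}^n$ and $0<\delta\le 1$. In $\mathbb Z_2$-synchronization with Bernoulli noise of parameter $\delta$, the cost matrix is the random symmetric matrix $C\in\mathbb R^{n\times n}$ with $C_{ii}=0$ whose entries $C_{ij}$, $i<j$, are independent with $C_{ij}=x_ix_j$ with probability $\frac{1+\delta}{2}$ and $C_{ij}=-x_ix_j$ with probability $\frac{1-\delta}{2}$. The Burer–Monteiro problem is $$\min_{V\in\mathbb R^{n\times p}}\ -\langle C,VV^T\rangle\quad\text{subject to}\quad \operatorname{diag}(VV^T)=\mathbf 1_n,$$ where $\langle A,B\rangle=\operatorname{tr}(A^TB)$; its feasible set is the product of spheres $(\mathbb S^{p-1})^n$, a Riemannian submanifold of $\mathbb R^{n\times p}$. A feasible point $V$ is a second-order critical point if the Riemannian gradient of the objective vanishes at $V$ and its Riemannian Hessian at $V$ is positive semidefinite on the tangent space. For every $\varepsilon>0$ there is $N$, depending only on $\varepsilon$, such that for all $n\ge N$, all $p\ge 2$, all $x\in\{\pm1\}^n$ and all $0<\delta\le 1$ with $$\delta>\frac{p+1}{p-1}\sqrt{\frac{(2+\varepsilon)\log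 n}{n}},$$ with probability at least $1-n^{-3}-n^{-\varepsilon/3}$ all second-order critical points $V$ of the Burer–Monteiro problem are optimal, that is, are global minimizers, and satisfy $VV^T=xx^T$. -/

import Mathlib

open MeasureTheory ProbabilityTheory
open scoped Matrix

noncomputable section

namespace BurerMonteiro

/-- The Euclidean space `ℝ^{n×p}`, with the Frobenius inner product; `V i` is the `i`-th row. -/
abbrev MatSpace (n p : ℕ) : Type := PiLp 2 (fun _ : Fin n => EuclideanSpace ℝ (Fin p))

variable {n p : ℕ}

/-- The array `V` as a matrix. -/
def toMatrix (V : MatSpace n p) : Matrix (Fin n) (Fin p) ℝ := Matrix.of fun i k => V i k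

/-- The matrix `V Vᵀ`. -/
def outer (V : MatSpace n p) : Matrix (Fin n) (Fin n) ℝ := toMatrix V * (toMatrix V)ᵀ

theorem outer_apply (V : MatSpace n p) (i j : Fin n) : outer V i j = inner ℝ (V i) (V j) := by
  simp [outer, toMatrix, Matrix.mul_apply, PiLp.inner_apply, mul_comm]

/-- The objective `V ↦ -⟨C, V Vᵀ⟩ = -tr(Cᵀ V Vᵀ)`, defined on all of `ℝ^{n×p}`. -/
def objective (C : Matrix (Fin n) (Fin n) ℝ) (V : MatSpace n p) : ℝ :=
  -(Cᵀ * outer V).trace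

/-- The feasible set `{V : diag(V Vᵀ) = 1}`. -/
def feasible (n p : ℕ) : Set (MatSpace n p) := {V | (outer V).diag = fun _ => 1}

/-- The feasible set is the product of unit spheres. -/
theorem mem_feasible_iff (V : MatSpace n p) : V ∈ feasible n p ↔ ∀ i, ‖V i‖ = 1 := by
  simp only [feasible, Set.mem_ofPred_eq, funext_iff, Matrix.diag_apply, outer_apply,
    real_inner_self_eq_norm_sq]
  exact forall_congr' fun i => by
    rw [pow_eq_one_iff_of_nonneg (norm_nonneg _) two_ne_zero]

/-- The tangent space `{U : diag(U Vᵀ) = 0}` of the product of spheres at `V`. -/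
def tangentSpace (V : MatSpace n p) : Submodule ℝ (MatSpace n p) where
  carrier := {U | ∀ i, inner ℝ (U i) (V i) = 0}
  add_mem' := by
    intro a b ha hb i
    simp [inner_add_left, ha i, hb i]
  zero_mem' := by
    intro i
    simp
  smul_mem' := by
    intro c a ha i
    simp [inner_smul_left, ha i]

/-- `tangentProj V Z = Z - ddiag(Z Vᵀ) V`; for `V` in the product of spheres this is the orthogonal
projection of `Z` onto the tangent space at `V`. -/
def tangentProj (V Z : MatSpace n p) : MatSpace n p :=
  WithLp.toLp 2 fun i => Z i - inner ℝ (Z i) (V i) • V i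

theorem tangentProj_mem {V : MatSpace n p} (hV : V ∈ feasible n p) (Z : MatSpace n p) :
    tangentProj V Z ∈ tangentSpace V := by
  intro i
  have h := (mem_feasible_iff V).1 hV i
  simp [tangentProj, inner_sub_left, inner_smul_left, h]

/-- On the product of spheres, `tangentProj` is the orthogonal projection onto the tangent space. -/
theorem tangentProj_eq_starProjection {V : MatSpace n p} (hV : V ∈ feasible n p)
    (Z : MatSpace n p) : (tangentSpace V).starProjection Z = tangentProj V Z := by
  refine Submodule.eq_starProjection_of_mem_of_inner_eq_zero (tangentProj_mem hV Z) ?_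
  intro U hU
  have hU' : ∀ i, inner ℝ (U i) (V i) = 0 := hU
  rw [PiLp.inner_apply]
  refine Finset.sum_eq_zero fun i _ => ?_
  have h : inner ℝ (V i) (U i) = 0 := by rw [real_inner_comm, hU' i]
  simp [tangentProj, inner_smul_left, h]

/-- Riemannian gradient on the product of spheres of (the restriction of) `f`: the tangential part
of the Euclidean gradient. The formula also extends it to a vector field on all of `ℝ^{n×p}`. -/
def riemGrad (f : MatSpace n p → ℝ) (V : MatSpace n p) : MatSpace n p :=
  tangentProj V (gradient f V)

/-- Riemannian Hessian at `V`, as a map on tangent vectors `U`: the covariant derivative of the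
Riemannian gradient for the induced metric, that is, the tangential part of the derivative of the
(extended) gradient field in direction `U`. -/
def riemHess (f : MatSpace n p → ℝ) (V U : MatSpace n p) : MatSpace n p :=
  tangentProj V (fderiv ℝ (riemGrad f) V U)

/-- `V` is a second-order critical point of the Burer-Monteiro problem with cost matrix `C`. -/
structure IsSOCP (C : Matrix (Fin n) (Fin n) ℝ) (V : MatSpace n p) : Prop where
  feasible : V ∈ feasible n p
  grad_eq_zero : riemGrad (objective C) V = 0
  hess_nonneg : ∀ U ∈ tangentSpace V, 0 ≤ inner ℝ (riemHess (objective C) V U) U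

/-- `V` is a global minimizer of the Burer-Monteiro problem with cost matrix `C`. -/
def IsOptimal (C : Matrix (Fin n) (Fin n) ℝ) (V : MatSpace n p) : Prop :=
  V ∈ feasible n p ∧ IsMinOn (objective C) (feasible n p) V

/-- The random matrix `C` is the cost matrix of `ℤ₂`-synchronization of the vector `x` with
Bernoulli noise of parameter `δ`: symmetric with zero diagonal, the entries above the diagonal are
independent, and each off-diagonal `C i j` is `x i * x j` with probability `(1 + δ) / 2` and
`-(x i * x j)` with probability `(1 - δ) / 2`. -/
structure IsBernoulliSync {Ω : Type*} [MeasurableSpace Ω] (μ : Measure Ω) (x : Fin n → ℝ) (δ : ℝ)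
    (C : Ω → Matrix (Fin n) (Fin n) ℝ) : Prop where
  measurable : ∀ i j, Measurable fun ω => C ω i j
  symm : ∀ ω, (C ω).IsSymm
  diag : ∀ ω i, C ω i i = 0
  prob_keep : ∀ i j, i ≠ j → μ {ω | C ω i j = x i * x j} = ENNReal.ofReal ((1 + δ) / 2)
  prob_flip : ∀ i j, i ≠ j → μ {ω | C ω i j = -(x i * x j)} = ENNReal.ofReal ((1 - δ) / 2)
  indep : iIndepFun (fun (e : {e : Fin n × Fin n // e.1 < e.2}) ω => C ω e.1.1 e.1.2) μ

end BurerMonteiro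

end

/-! Replacing each row `V i` by `x i • V i` reduces to planted signs all 1, where `C = δJ + W` with
`W` of operator norm at most `κ = O(√n)` and all row sums of `C` exceeding some `m`. The rest of the
landscape argument is deterministic. The second-order condition, averaged over the projected basis
directions `basisProj`, forces `g = ∑ V i` to satisfy `‖g‖ ≥ n/2` (`sq_div_four_le_norm_sum_sq`).
With `u = g/‖g‖`, the first-order condition reads `Λ i V i = δ‖g‖ u + (WV) i`, and `Λ i ≥ 0` then
shows that the total misalignment `σ = ∑ (1 - ⟨V i, u⟩)` is `O(κ²/(δ²n))`. Testing the first-order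
condition with `u` and expanding the Laplacian form around `u` gives `m σ ≤ (δσ + 2κ) σ`. Since `m`
exceeds `δσ + 2κ`, `σ = 0` and all rows coincide (`exists_forall_eq`). Optimality is positivity of
the Laplacian of `C` (`sum_sum_mul_inner_le`). Hoeffding's inequality supplies the two events: a net
argument bounds the noise norm by `16√n`, and a union bound over rows keeps every row sum above a
multiple of `√(n log n)`, which dominates `κ`. The factor `(p+1)/(p-1)` enters only through being at
least 1. -/

namespace BurerMonteiro

/-- The operator norm of the matrix `W` is at most `κ`. -/
def OpBound {n : ℕ} (W : Matrix (Fin n) (Fin n) ℝ) (κ : ℝ) : Prop :=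
  ∀ a : Fin n → ℝ, ∑ i, (∑ j, W i j * a j) ^ 2 ≤ κ ^ 2 * ∑ j, a j ^ 2

/-! ### Deterministic landscape analysis for `C = δJ + W`. -/

section Deterministic

variable {n p : ℕ} {ι : Type*} [Fintype ι]

theorem OpBound.sum_norm_sq_le {W : Matrix (Fin n) (Fin n) ℝ} {κ : ℝ} (hW : OpBound W κ)
    (A : Fin n → EuclideanSpace ℝ ι) :
    ∑ i, ‖∑ j, W i j • A j‖ ^ 2 ≤ κ ^ 2 * ∑ j, ‖A j‖ ^ 2 := by
  simp only [EuclideanSpace.real_norm_sq_eq, WithLp.ofLp_sum, Finset.sum_apply, WithLp.ofLp_smul,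
    Pi.smul_apply, smul_eq_mul]
  rw [Finset.sum_comm, Finset.sum_comm (s := Finset.univ (α := Fin n)), Finset.mul_sum]
  exact Finset.sum_le_sum fun k _ => hW fun j => A j k

theorem OpBound.abs_sum_inner_le {W : Matrix (Fin n) (Fin n) ℝ} {κ : ℝ} (hW : OpBound W κ)
    (hκ : 0 < κ) (A : Fin n → EuclideanSpace ℝ ι) :
    |∑ i, ∑ j, W i j * inner ℝ (A i) (A j)| ≤ κ * ∑ j, ‖A j‖ ^ 2 := by
  have h1 : ∑ i, ∑ j, W i j * inner ℝ (A i) (A j) = ∑ i, inner ℝ (A i) (∑ j, W i j • A j) := by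
    simp only [inner_sum, inner_smul_right]
  -- Cauchy–Schwarz, then AM–GM weighted by `κ`, so that the bound `κ²` on the squared norm balances
  -- the two terms.
  have h2 : ∀ i, |inner ℝ (A i) (∑ j, W i j • A j)| ≤
      (κ * ‖A i‖ ^ 2 + κ⁻¹ * ‖∑ j, W i j • A j‖ ^ 2) / 2 := fun i => by
    refine (abs_real_inner_le_norm _ _).trans ?_
    have h : 0 ≤ κ⁻¹ * (κ * ‖A i‖ - ‖∑ j, W i j • A j‖) ^ 2 := by positivity
    have h' : κ⁻¹ * (κ * ‖A i‖ - ‖∑ j, W i j • A j‖) ^ 2 =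
        κ * ‖A i‖ ^ 2 + κ⁻¹ * ‖∑ j, W i j • A j‖ ^ 2 - 2 * (‖A i‖ * ‖∑ j, W i j • A j‖) := by
      field_simp; ring
    linarith
  rw [h1]
  refine (Finset.abs_sum_le_sum_abs _ _).trans ((Finset.sum_le_sum fun i _ => h2 i).trans ?_)
  rw [← Finset.sum_div, Finset.sum_add_distrib, ← Finset.mul_sum, ← Finset.mul_sum]
  have h3 := mul_le_mul_of_nonneg_left (hW.sum_norm_sq_le A) (inv_nonneg.2 hκ.le)
  have h4 : κ⁻¹ * (κ ^ 2 * ∑ j, ‖A j‖ ^ 2) = κ * ∑ j, ‖A j‖ ^ 2 := by field_simp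
  linarith

/-- The quadratic form of a graph Laplacian is invariant under translation. -/
theorem sum_mul_one_sub_inner {C : Matrix (Fin n) (Fin n) ℝ} (hC : C.IsSymm)
    {V : Fin n → EuclideanSpace ℝ ι} (hV : ∀ i, ‖V i‖ = 1) (h : EuclideanSpace ℝ ι) :
    ∑ i, ∑ j, C i j * (1 - inner ℝ (V i) (V j)) =
      ∑ i, (∑ j, C i j) * ‖V i - h‖ ^ 2 - ∑ i, ∑ j, C i j * inner ℝ (V i - h) (V j - h) := by
  have h1 : ∑ i, ∑ j, C i j * ‖V i - h‖ ^ 2 = ∑ i, ∑ j, C i j * ‖V j - h‖ ^ 2 := by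
    rw [Finset.sum_comm]
    exact Finset.sum_congr rfl fun i _ => Finset.sum_congr rfl fun j _ => by rw [hC.apply]
  have h2 : ∀ i j, C i j * (1 - inner ℝ (V i) (V j)) = (C i j * ‖V i - h‖ ^ 2) / 2 +
      (C i j * ‖V j - h‖ ^ 2) / 2 - C i j * inner ℝ (V i - h) (V j - h) := fun i j => by
    have h3 : ‖V i - V j‖ ^ 2 = ‖(V i - h) - (V j - h)‖ ^ 2 := by congr 2; abel
    rw [norm_sub_sq_real, norm_sub_sq_real, hV, hV] at h3
    linear_combination (C i j / 2) * h3
  simp only [h2, Finset.sum_sub_distrib, Finset.sum_add_distrib, ← Finset.sum_div, ← h1,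
    Finset.sum_mul]
  ring

theorem sum_mul_inner_eq (C : Matrix (Fin n) (Fin n) ℝ) (δ : ℝ) (A : Fin n → EuclideanSpace ℝ ι) :
    ∑ i, ∑ j, C i j * inner ℝ (A i) (A j) =
      δ * ‖∑ i, A i‖ ^ 2 + ∑ i, ∑ j, (C i j - δ) * inner ℝ (A i) (A j) := by
  rw [← real_inner_self_eq_norm_sq, sum_inner]
  simp only [inner_sum, Finset.mul_sum, ← Finset.sum_add_distrib]
  exact Finset.sum_congr rfl fun i _ => Finset.sum_congr rfl fun j _ => by ring

/-- The projection of the `k`-th basis vector onto the tangent space of the sphere at `a`. -/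
noncomputable def basisProj (k : Fin p) (a : EuclideanSpace ℝ (Fin p)) : EuclideanSpace ℝ (Fin p) :=
  EuclideanSpace.single k 1 - a k • a

theorem inner_basisProj_self (k : Fin p) {a : EuclideanSpace ℝ (Fin p)} (ha : ‖a‖ = 1) :
    inner ℝ (basisProj k a) a = 0 := by
  simp [basisProj, inner_sub_left, inner_smul_left, EuclideanSpace.inner_single_left, ha]

theorem sum_inner_basisProj {a b : EuclideanSpace ℝ (Fin p)} (ha : ‖a‖ = 1) (hb : ‖b‖ = 1) :
    ∑ k, inner ℝ (basisProj k a) (basisProj k b) = (p : ℝ) - 2 + inner ℝ a b ^ 2 := by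
  have h : ∀ k, inner ℝ (basisProj k a) (basisProj k b) =
      1 - b k ^ 2 - a k ^ 2 + inner ℝ a b * (b k * a k) := fun k => by
    simp only [basisProj, inner_sub_left, inner_sub_right, inner_smul_left, inner_smul_right,
      EuclideanSpace.inner_single_left, EuclideanSpace.inner_single_right]
    simp
    ring
  have h1 : inner ℝ a b = ∑ k, b k * a k := by simp [PiLp.inner_apply]
  simp only [h, Finset.sum_add_distrib, Finset.sum_sub_distrib, ← Finset.mul_sum,
    ← EuclideanSpace.real_norm_sq_eq, ha, hb, ← h1]
  simp
  ring

/-- With `M = VᵀV` of size `p × p`, this is `(tr M)² ≤ p ‖M‖_F²`: only the diagonal of `M` is kept,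
and Cauchy–Schwarz applied to it. -/
theorem sq_sum_norm_sq_le (V : Fin n → EuclideanSpace ℝ (Fin p)) :
    (∑ i, ‖V i‖ ^ 2) ^ 2 ≤ p * ∑ i, ∑ j, inner ℝ (V i) (V j) ^ 2 := by
  have h1 : ∑ i, ∑ j, inner ℝ (V i) (V j) ^ 2 = ∑ k, ∑ l, (∑ i, V i k * V i l) ^ 2 := by
    have e1 : ∀ i j, inner ℝ (V i) (V j) ^ 2 = ∑ k, ∑ l, (V j k * V i k) * (V j l * V i l) :=
      fun i j => by
        rw [sq, PiLp.inner_apply, Finset.sum_mul_sum]; simp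
    have e2 : ∀ k l, (∑ i, V i k * V i l) ^ 2 = ∑ i, ∑ j, (V j k * V i k) * (V j l * V i l) :=
      fun k l => by
        rw [sq, Finset.sum_mul_sum]
        exact Finset.sum_congr rfl fun i _ => Finset.sum_congr rfl fun j _ => by ring
    simp only [e1, e2]
    calc _ = ∑ i, ∑ k, ∑ j, ∑ l, (V j k * V i k) * (V j l * V i l) :=
          Finset.sum_congr rfl fun i _ => Finset.sum_comm
      _ = ∑ k, ∑ i, ∑ j, ∑ l, (V j k * V i k) * (V j l * V i l) := Finset.sum_comm
      _ = ∑ k, ∑ i, ∑ l, ∑ j, (V j k * V i k) * (V j l * V i l) :=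
          Finset.sum_congr rfl fun i _ => Finset.sum_congr rfl fun i _ => Finset.sum_comm
      _ = _ := Finset.sum_congr rfl fun i _ => Finset.sum_comm
  have h2 : ∑ i, ‖V i‖ ^ 2 = ∑ k, ∑ i, V i k * V i k := by
    simp only [EuclideanSpace.real_norm_sq_eq, ← sq]
    exact Finset.sum_comm
  rw [h1, h2]
  have h3 := sq_sum_le_card_mul_sum_sq (s := Finset.univ) (f := fun k => ∑ i, V i k * V i k)
  simp only [Finset.card_univ, Fintype.card_fin] at h3
  refine h3.trans (mul_le_mul_of_nonneg_left (Finset.sum_le_sum fun k _ => ?_) (by positivity))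
  exact Finset.single_le_sum (f := fun l => (∑ i, V i k * V i l) ^ 2)
    (fun _ _ => sq_nonneg _) (Finset.mem_univ k)

/-- The first- and second-order conditions for the family `V` of unit vectors, in coordinates. -/
structure IsCritical (C : Matrix (Fin n) (Fin n) ℝ) (V : Fin n → EuclideanSpace ℝ (Fin p))
    (Λ : Fin n → ℝ) : Prop where
  norm_eq_one : ∀ i, ‖V i‖ = 1
  first_order : ∀ i, ∑ j, C i j • V j = Λ i • V i
  second_order : ∀ U : Fin n → EuclideanSpace ℝ (Fin p), (∀ i, inner ℝ (U i) (V i) = 0) →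
    ∑ i, ∑ j, C i j * inner ℝ (U i) (U j) ≤ ∑ i, Λ i * ‖U i‖ ^ 2

namespace IsCritical

variable {C : Matrix (Fin n) (Fin n) ℝ} {V : Fin n → EuclideanSpace ℝ (Fin p)} {Λ : Fin n → ℝ}

theorem multiplier_eq (h : IsCritical C V Λ) (i : Fin n) :
    Λ i = ∑ j, C i j * inner ℝ (V i) (V j) := by
  have h1 := congrArg (inner ℝ (V i)) (h.first_order i)
  simpa [inner_sum, inner_smul_right, h.norm_eq_one i] using h1.symm

/-- A direction moving only row `i` sees `C i i = 0` on the left of the second-order condition.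
Summing over the projected basis vectors gives `0 ≤ (p - 1) Λ i`. -/
theorem multiplier_nonneg (h : IsCritical C V Λ) (hp : 2 ≤ p) (hC : ∀ i, C i i = 0) (i : Fin n) :
    0 ≤ Λ i := by
  have h1 : ∀ k, 0 ≤ Λ i * inner ℝ (basisProj k (V i)) (basisProj k (V i)) := fun k => by
    have h2 := h.second_order (fun j => if j = i then basisProj k (V i) else 0) fun j => by
      by_cases hj : j = i
      · subst hj; simp [inner_basisProj_self k (h.norm_eq_one j)]
      · simp [hj]
    rw [Finset.sum_eq_single i (fun j _ hj => by simp [hj]) (by simp),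
      Finset.sum_eq_single i (fun j _ hj => by simp [hj]) (by simp),
      Finset.sum_eq_single i (fun j _ hj => by simp [hj]) (by simp)] at h2
    simpa [hC i] using h2
  have h3 := Finset.sum_nonneg fun k (_ : k ∈ Finset.univ) => h1 k
  rw [← Finset.mul_sum, sum_inner_basisProj (h.norm_eq_one i) (h.norm_eq_one i)] at h3
  have h4 : (2 : ℝ) ≤ p := by exact_mod_cast hp
  simp only [real_inner_self_eq_norm_sq, h.norm_eq_one i] at h3
  exact nonneg_of_mul_nonneg_left h3 (by linarith)

/-- All rows are moved in the common direction `e_k`, projected to the tangent spaces; the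
second-order conditions are then summed over `k`. -/
theorem sum_mul_le (h : IsCritical C V Λ) :
    ∑ i, ∑ j, C i j * ((p : ℝ) - 2 + inner ℝ (V i) (V j) ^ 2) ≤
      ((p : ℝ) - 1) * ∑ i, ∑ j, C i j * inner ℝ (V i) (V j) := by
  have h1 := Finset.sum_le_sum fun k (_ : k ∈ (Finset.univ : Finset (Fin p))) =>
    h.second_order (fun i => basisProj k (V i)) fun i => inner_basisProj_self k (h.norm_eq_one i)
  simp only [← real_inner_self_eq_norm_sq] at h1
  rw [Finset.sum_comm, Finset.sum_comm (t := Finset.univ (α := Fin n))] at h1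
  simp_rw [← Finset.mul_sum] at h1
  rw [Finset.sum_congr rfl fun i _ => Finset.sum_comm] at h1
  simp_rw [← Finset.mul_sum, sum_inner_basisProj (h.norm_eq_one _) (h.norm_eq_one _)] at h1
  refine h1.trans (le_of_eq ?_)
  rw [Finset.mul_sum]
  refine Finset.sum_congr rfl fun i _ => ?_
  rw [← h.multiplier_eq i, real_inner_self_eq_norm_sq, h.norm_eq_one i]
  ring

end IsCritical

theorem OpBound.abs_sum_le {W : Matrix (Fin n) (Fin n) ℝ} {κ : ℝ} (hW : OpBound W κ)
    (hκ : 0 < κ) : |∑ i, ∑ j, W i j| ≤ κ * n := by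
  simpa using hW.abs_sum_inner_le hκ fun _ => EuclideanSpace.single (0 : Fin 1) (1 : ℝ)

/-- Squared inner products are inner products of the tensor squares `A i ⊗ A i`, to which the linear
bound applies. -/
theorem OpBound.abs_sum_inner_sq_le {W : Matrix (Fin n) (Fin n) ℝ} {κ : ℝ} (hW : OpBound W κ)
    (hκ : 0 < κ) (A : Fin n → EuclideanSpace ℝ ι) :
    |∑ i, ∑ j, W i j * inner ℝ (A i) (A j) ^ 2| ≤ κ * ∑ j, (‖A j‖ ^ 2) ^ 2 := by
  let T : Fin n → EuclideanSpace ℝ (ι × ι) := fun i => WithLp.toLp 2 fun q => A i q.1 * A i q.2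
  have h : ∀ i j, inner ℝ (T i) (T j) = inner ℝ (A i) (A j) ^ 2 := fun i j => by
    rw [sq, PiLp.inner_apply, PiLp.inner_apply, Finset.sum_mul_sum, ← Finset.sum_product',
      Finset.univ_product_univ]
    exact Finset.sum_congr rfl fun q _ => by simp [T]; ring
  have h1 := hW.abs_sum_inner_le hκ T
  simpa only [← real_inner_self_eq_norm_sq, h] using h1

/-- Put `c = ⟨v, u⟩`. If `c ≥ 0`, the distance from `b u` to the line of `v` gives `‖w‖² ≥ b²(1 -
c²) ≥ b²(1 - c)`. If `c ≤ 0`, then `a ≥ 0` gives `‖w‖² ≥ b² ≥ b²(1 - c)/2`. -/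
theorem half_mul_sq_mul_one_sub_inner_le {E : Type*} [NormedAddCommGroup E] [InnerProductSpace ℝ E]
    {u v w : E} {a b : ℝ} (hu : ‖u‖ = 1) (hv : ‖v‖ = 1) (ha : 0 ≤ a) (hb : 0 ≤ b)
    (h : a • v = b • u + w) : b ^ 2 * (1 - inner ℝ v u) ≤ 2 * ‖w‖ ^ 2 := by
  have hw : w = a • v - b • u := by rw [h]; abel
  have h1 : ‖w‖ ^ 2 = a ^ 2 - 2 * (a * b * inner ℝ v u) + b ^ 2 := by
    rw [hw, norm_sub_sq_real, inner_smul_left, inner_smul_right, norm_smul, norm_smul, hu, hv]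
    simp
    ring
  have h2 : -1 ≤ inner ℝ v u := by
    have := neg_le_of_abs_le (abs_real_inner_le_norm v u)
    rwa [hu, hv, one_mul] at this
  have h3 : inner ℝ v u ≤ 1 := by
    have := le_of_abs_le (abs_real_inner_le_norm v u)
    rwa [hu, hv, one_mul] at this
  rw [h1]
  rcases le_total 0 (inner ℝ v u) with hc | hc
  · nlinarith [sq_nonneg (a - b * inner ℝ v u),
      mul_nonneg (mul_nonneg (sq_nonneg b) hc) (sub_nonneg.2 h3),
      mul_nonneg (sq_nonneg b) (sub_nonneg.2 h3)]
  · nlinarith [mul_nonneg (mul_nonneg ha hb) (neg_nonneg.2 hc), sq_nonneg a,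
      mul_nonneg (sq_nonneg b) (neg_le_iff_add_nonneg.1 h2)]

theorem sum_sum_mul_inner_le {C : Matrix (Fin n) (Fin n) ℝ} {δ κ m : ℝ} (hC : C.IsSymm)
    (hn : n ≠ 0) (hκ : 0 < κ) (hW : OpBound (C - Matrix.of fun _ _ => δ) κ)
    (hm : ∀ i, m ≤ ∑ j, C i j) (hκm : κ ≤ m)
    {V : Fin n → EuclideanSpace ℝ ι} (hV : ∀ i, ‖V i‖ = 1) :
    ∑ i, ∑ j, C i j * inner ℝ (V i) (V j) ≤ ∑ i, ∑ j, C i j := by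
  -- Centring at the mean kills the `δJ` part, leaving only `W` against the row sums.
  set h : EuclideanSpace ℝ ι := (n : ℝ)⁻¹ • ∑ i, V i
  have hn' : (n : ℝ) ≠ 0 := by exact_mod_cast hn
  have h0 : ∑ i, (V i - h) = 0 := by
    simp [h, Finset.sum_sub_distrib, ← Nat.cast_smul_eq_nsmul ℝ, smul_smul, hn']
  have h1 := sum_mul_one_sub_inner hC hV h
  have h2 := sum_mul_inner_eq C δ fun i => V i - h
  have h3 := le_of_abs_le (hW.abs_sum_inner_le hκ fun i => V i - h)
  have h4 : κ * ∑ i, ‖V i - h‖ ^ 2 ≤ ∑ i, (∑ j, C i j) * ‖V i - h‖ ^ 2 := by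
    rw [Finset.mul_sum]
    exact Finset.sum_le_sum fun i _ =>
      mul_le_mul_of_nonneg_right (hκm.trans (hm i)) (sq_nonneg _)
  simp only [Matrix.sub_apply, Matrix.of_apply] at h3
  simp only [mul_sub, mul_one, Finset.sum_sub_distrib] at h1
  simp only [h0, norm_zero] at h2
  linarith

namespace IsCritical

variable {C : Matrix (Fin n) (Fin n) ℝ} {V : Fin n → EuclideanSpace ℝ (Fin p)} {Λ : Fin n → ℝ}
  {δ κ m : ℝ}

theorem sq_div_four_le_norm_sum_sq (h : IsCritical C V Λ) (hp : 2 ≤ p) (hδ : 0 < δ) (hκ : 0 < κ)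
    (hW : OpBound (C - Matrix.of fun _ _ => δ) κ) (hκδ : 8 * κ ≤ δ * n) :
    (n : ℝ) ^ 2 / 4 ≤ ‖∑ i, V i‖ ^ 2 := by
  have hp' : (2 : ℝ) ≤ p := by exact_mod_cast hp
  have e1 := sum_mul_inner_eq C δ V
  have w0 := hW.abs_sum_le hκ
  have w1 := hW.abs_sum_inner_le hκ V
  have w2 := hW.abs_sum_inner_sq_le hκ V
  have q := sq_sum_norm_sq_le V
  have s := h.sum_mul_le
  simp only [h.norm_eq_one, one_pow, Finset.sum_const, Finset.card_univ, Fintype.card_fin,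
    nsmul_eq_mul, mul_one, Matrix.sub_apply, Matrix.of_apply] at w0 w1 w2 q
  have e2 : ∑ i, ∑ j, C i j * ((p : ℝ) - 2 + inner ℝ (V i) (V j) ^ 2) =
      δ * ((p - 2) * n ^ 2 + ∑ i, ∑ j, inner ℝ (V i) (V j) ^ 2) +
      (p - 2) * (∑ i, ∑ j, (C i j - δ)) + ∑ i, ∑ j, (C i j - δ) * inner ℝ (V i) (V j) ^ 2 := by
    have e3 : (p - 2 : ℝ) * n ^ 2 = ∑ i : Fin n, ∑ j : Fin n, ((p : ℝ) - 2) := by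
      simp; ring
    rw [e3]
    simp only [Finset.mul_sum, ← Finset.sum_add_distrib]
    exact Finset.sum_congr rfl fun i _ => Finset.sum_congr rfl fun j _ => by ring
  rw [e1, e2] at s
  generalize ∑ i, ∑ j, (C i j - δ) = a0 at *
  generalize ∑ i, ∑ j, (C i j - δ) * inner ℝ (V i) (V j) = a1 at *
  generalize ∑ i, ∑ j, (C i j - δ) * inner ℝ (V i) (V j) ^ 2 = a2 at *
  generalize ∑ i, ∑ j, inner ℝ (V i) (V j) ^ 2 = z at *
  generalize ‖∑ i, V i‖ ^ 2 = g at *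
  have b0 := mul_le_mul_of_nonneg_left (neg_le_of_abs_le w0) (by linarith : (0 : ℝ) ≤ p - 2)
  have b1 := mul_le_mul_of_nonneg_left (le_of_abs_le w1) (by linarith : (0 : ℝ) ≤ p - 1)
  have b2 := neg_le_of_abs_le w2
  have b3 : (p - 1) * (8 * κ * n) ≤ (p - 1) * (δ * n * n) :=
    mul_le_mul_of_nonneg_left (mul_le_mul_of_nonneg_right hκδ (by positivity)) (by linarith)
  -- The three noise terms total `((p-2) + (p-1) + 1) κ n = 2(p-1) κ n`, at most `(p-1) δ n²/4`.
  have b4 : δ * ((p - 2) * n ^ 2 + z) ≤ δ * ((p - 1) * (g + n ^ 2 / 4)) := by nlinarith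
  have b5 := le_of_mul_le_mul_left b4 hδ
  -- Uses `z ≥ n²/p` and `(p - 2) + 1/p = (p - 1)²/p`; afterwards `(p - 1)/p ≥ 1/2`.
  have b6 : (p - 1) * ((p : ℝ) - 1) * n ^ 2 ≤ (p - 1) * (p * (g + n ^ 2 / 4)) := by
    nlinarith [mul_le_mul_of_nonneg_left b5 (by linarith : (0 : ℝ) ≤ p)]
  rw [mul_assoc] at b6
  have b7 := le_of_mul_le_mul_left b6 (by linarith)
  have b8 : p * (n ^ 2 / 2 : ℝ) ≤ p * (g + n ^ 2 / 4) := by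
    nlinarith [mul_nonneg (by linarith : (0 : ℝ) ≤ p - 2) (sq_nonneg (n : ℝ))]
  have b9 := le_of_mul_le_mul_left b8 (by linarith)
  linarith

theorem exists_forall_eq (h : IsCritical C V Λ) (hC : C.IsSymm) (hC0 : ∀ i, C i i = 0) (hp : 2 ≤ p)
    (hn : n ≠ 0) (hδ : 0 < δ) (hκ : 0 < κ) (hW : OpBound (C - Matrix.of fun _ _ => δ) κ)
    (hκδ : 8 * κ ≤ δ * n) (hm : ∀ i, m ≤ ∑ j, C i j) (hκm : 8 * κ ^ 2 / (δ * n) + 2 * κ < m) :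
    ∃ u, ∀ i, V i = u := by
  have hn0 : (0 : ℝ) < n := by exact_mod_cast Nat.pos_of_ne_zero hn
  set g := ∑ i, V i with hg
  have hg2 : (n : ℝ) ^ 2 / 4 ≤ ‖g‖ ^ 2 := h.sq_div_four_le_norm_sum_sq hp hδ hκ hW hκδ
  have hg0 : 0 < ‖g‖ := by
    refine (norm_nonneg g).lt_of_ne fun h0 => ?_
    rw [← h0] at hg2
    have : 0 < (n : ℝ) ^ 2 := by positivity
    linarith
  set u := ‖g‖⁻¹ • g with hu
  have hu1 : ‖u‖ = 1 := by rw [hu, norm_smul, norm_inv, norm_norm, inv_mul_cancel₀ hg0.ne']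
  have hgu : g = ‖g‖ • u := by rw [hu, smul_smul, mul_inv_cancel₀ hg0.ne', one_smul]
  set σ := ∑ i, (1 - inner ℝ (V i) u) with hσ
  have hc : ∀ i, 0 ≤ 1 - inner ℝ (V i) u := fun i => by
    have := le_of_abs_le (abs_real_inner_le_norm (V i) u)
    rw [hu1, h.norm_eq_one, one_mul] at this
    linarith
  have hσ0 : 0 ≤ σ := Finset.sum_nonneg fun i _ => hc i
  have hσg : σ = n - ‖g‖ := by
    rw [hσ, Finset.sum_sub_distrib, ← sum_inner, ← hg, hgu, inner_smul_left]
    simp [norm_smul, hu1]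
  have hΛ := h.multiplier_nonneg hp hC0
  have hv : ∀ i, ‖V i - u‖ ^ 2 = 2 * (1 - inner ℝ (V i) u) := fun i => by
    rw [norm_sub_sq_real, h.norm_eq_one, hu1]; ring
  have hvs : ∑ i, ‖V i - u‖ ^ 2 = 2 * σ := by simp only [hv, ← Finset.mul_sum, hσ]
  -- The family is close to `u` in the mean square.
  have hclose : δ * σ ≤ 8 * κ ^ 2 / (δ * n) := by
    have h1 : ∀ i, (δ * ‖g‖) ^ 2 * (1 - inner ℝ (V i) u) ≤
        2 * ‖∑ j, (C - Matrix.of fun _ _ => δ : Matrix (Fin n) (Fin n) ℝ) i j • V j‖ ^ 2 := fun i => by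
      refine half_mul_sq_mul_one_sub_inner_le hu1 (h.norm_eq_one i) (hΛ i) (by positivity) ?_
      simp only [Matrix.sub_apply, Matrix.of_apply, sub_smul, Finset.sum_sub_distrib,
        h.first_order i, mul_smul, ← hgu, ← Finset.smul_sum, ← hg]
      abel
    have h2 := Finset.sum_le_sum fun i (_ : i ∈ Finset.univ) => h1 i
    rw [← Finset.mul_sum, ← Finset.mul_sum, ← hσ] at h2
    have h3 := hW.sum_norm_sq_le V
    simp only [h.norm_eq_one, one_pow, Finset.sum_const, Finset.card_univ, Fintype.card_fin,
      nsmul_eq_mul, mul_one] at h3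
    rw [le_div_iff₀ (by positivity)]
    have h4 : δ ^ 2 * (n ^ 2 / 4) * σ ≤ 2 * (κ ^ 2 * n) := by
      refine le_trans ?_ (h2.trans (mul_le_mul_of_nonneg_left h3 (by norm_num)))
      rw [mul_pow]
      gcongr
    refine le_of_mul_le_mul_right ?_ hn0
    linarith
  -- The first-order condition, tested with `u`.
  have htest : ∑ i, ∑ j, C i j * (1 - inner ℝ (V i) (V j)) ≤
      ∑ i, (∑ j, C i j) * (1 - inner ℝ (V i) u) := by
    have h1 : ∑ i, Λ i * inner ℝ (V i) u = ∑ i, (∑ j, C i j) * inner ℝ (V i) u := by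
      have h2 : ∀ i, Λ i * inner ℝ (V i) u = ∑ j, C i j * inner ℝ (V j) u := fun i => by
        have := congrArg (inner ℝ · u) (h.first_order i)
        simpa [sum_inner, inner_smul_left] using this.symm
      simp only [h2, Finset.sum_mul]
      rw [Finset.sum_comm]
      exact Finset.sum_congr rfl fun i _ => Finset.sum_congr rfl fun j _ => by rw [hC.apply]
    have h3 : ∑ i, Λ i * inner ℝ (V i) u ≤ ∑ i, Λ i := Finset.sum_le_sum fun i _ => by
      nlinarith [mul_nonneg (hΛ i) (hc i)]
    have h4 : ∑ i, ∑ j, C i j * (1 - inner ℝ (V i) (V j)) = ∑ i, ∑ j, C i j - ∑ i, Λ i := by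
      simp only [mul_sub, mul_one, Finset.sum_sub_distrib, h.multiplier_eq]
    simp only [mul_sub, mul_one, Finset.sum_sub_distrib] at h4 ⊢
    linarith
  rw [sum_mul_one_sub_inner hC h.norm_eq_one u, sum_mul_inner_eq C δ] at htest
  -- The `δJ` part is quadratic in `σ`, because `∑ (V i - u) = (‖g‖ - n) u`.
  have h5 : ‖∑ i, (V i - u)‖ ^ 2 = σ ^ 2 := by
    have : ∑ i, (V i - u) = -(σ • u) := by
      rw [Finset.sum_sub_distrib, ← hg, hσg, sub_smul, ← hgu]
      simp [← Nat.cast_smul_eq_nsmul ℝ]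
    rw [this, norm_neg, norm_smul, hu1, mul_one, Real.norm_eq_abs, sq_abs]
  have h6 := le_of_abs_le (hW.abs_sum_inner_le hκ fun i => V i - u)
  simp only [Matrix.sub_apply, Matrix.of_apply] at h6
  rw [hvs] at h6
  have h7 : m * σ ≤ ∑ i, (∑ j, C i j) * (1 - inner ℝ (V i) u) := by
    rw [hσ, Finset.mul_sum]
    exact Finset.sum_le_sum fun i _ => mul_le_mul_of_nonneg_right (hm i) (hc i)
  have h8 : ∑ i, (∑ j, C i j) * ‖V i - u‖ ^ 2 =
      2 * ∑ i, (∑ j, C i j) * (1 - inner ℝ (V i) u) := by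
    rw [Finset.mul_sum]
    exact Finset.sum_congr rfl fun i _ => by rw [hv]; ring
  rw [h5, h8] at htest
  have hσz : σ = 0 := by
    by_contra hne
    have hpos : 0 < σ := hσ0.lt_of_ne' hne
    have h9 : m * σ ≤ (δ * σ + 2 * κ) * σ := by linarith
    have h10 := le_of_mul_le_mul_right h9 hpos
    linarith
  refine ⟨u, fun i => ?_⟩
  have h11 := (Finset.sum_eq_zero_iff_of_nonneg fun i _ => hc i).1 hσz i (Finset.mem_univ i)
  have h12 := hv i
  rw [h11, mul_zero] at h12
  exact sub_eq_zero.1 (norm_eq_zero.1 (pow_eq_zero_iff two_ne_zero |>.1 h12))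

end IsCritical

end Deterministic

/-! ### Riemannian conditions in coordinates, and reduction to trivial signs. -/

section Calculus

variable {n p : ℕ}

theorem exists_hasFDerivAt_smul_sub_inner_smul {H E : Type*} [NormedAddCommGroup H]
    [NormedSpace ℝ H] [NormedAddCommGroup E] [InnerProductSpace ℝ E] (c : ℝ) (g q : H →L[ℝ] E)
    (V : H) :
    ∃ D : H →L[ℝ] E, HasFDerivAt (fun V => c • (g V - inner ℝ (g V) (q V) • q V)) D V ∧
      ∀ U, D U = c • (g U - (inner ℝ (g V) (q V) • q U +
        (inner ℝ (g V) (q U) + inner ℝ (g U) (q V)) • q V)) := by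
  refine ⟨_, (g.hasFDerivAt.sub
    ((g.hasFDerivAt.inner ℝ q.hasFDerivAt).smul q.hasFDerivAt)).const_smul c, fun U => ?_⟩
  simp

theorem apply_fderiv_eq {H E F : Type*} [NormedAddCommGroup H] [NormedSpace ℝ H]
    [NormedAddCommGroup E] [NormedSpace ℝ E] [NormedAddCommGroup F] [NormedSpace ℝ F] {f : H → E}
    {V : H} (q : E →L[ℝ] F) (hf : DifferentiableAt ℝ f V) {D : H →L[ℝ] F}
    (hD : HasFDerivAt (fun V => q (f V)) D V) (U : H) : q (fderiv ℝ f V U) = D U := by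
  rw [← (q.hasFDerivAt.comp V hf.hasFDerivAt).unique hD]
  rfl

theorem hasGradientAt_neg_inner_self {H : Type*} [NormedAddCommGroup H] [InnerProductSpace ℝ H]
    [CompleteSpace H] {A : H →L[ℝ] H} (hA : ∀ V U, inner ℝ (A V) U = inner ℝ (A U) V) (V : H) :
    HasGradientAt (fun V => -inner ℝ (A V) V) ((-2 : ℝ) • A V) V := by
  rw [hasGradientAt_iff_hasFDerivAt]
  refine ((A.hasFDerivAt (x := V)).inner ℝ (hasFDerivAt_id V)).fun_neg.congr_fderiv ?_
  ext1 U
  have h := hA U V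
  simp [h]
  ring

theorem objective_eq (C : Matrix (Fin n) (Fin n) ℝ) (V : MatSpace n p) :
    objective C V = -∑ i, ∑ j, C i j * inner ℝ (V i) (V j) := by
  rw [objective, Matrix.trace, Finset.sum_comm]
  simp [Matrix.mul_apply, outer_apply]

/-- The linear map `V ↦ C V`. -/
noncomputable def mulCLM (C : Matrix (Fin n) (Fin n) ℝ) : MatSpace n p →L[ℝ] MatSpace n p :=
  (PiLp.continuousLinearEquiv 2 ℝ
      fun _ : Fin n => EuclideanSpace ℝ (Fin p)).symm.toContinuousLinearMap.comp
    (ContinuousLinearMap.pi fun i =>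
      ∑ j, C i j • PiLp.proj 2 (fun _ : Fin n => EuclideanSpace ℝ (Fin p)) j)

@[simp]
theorem mulCLM_apply (C : Matrix (Fin n) (Fin n) ℝ) (V : MatSpace n p) (i : Fin n) :
    mulCLM C V i = ∑ j, C i j • V j := by
  simp [mulCLM]

theorem inner_mulCLM (C : Matrix (Fin n) (Fin n) ℝ) (V U : MatSpace n p) :
    inner ℝ (mulCLM C V) U = ∑ i, ∑ j, C i j * inner ℝ (V j) (U i) := by
  simp [PiLp.inner_apply, sum_inner, inner_smul_left]

theorem objective_eq_neg_inner (C : Matrix (Fin n) (Fin n) ℝ) (V : MatSpace n p) :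
    objective C V = -inner ℝ (mulCLM C V) V := by
  rw [objective_eq, inner_mulCLM]
  simp only [real_inner_comm]

theorem inner_mulCLM_comm {C : Matrix (Fin n) (Fin n) ℝ} (hC : C.IsSymm) (V U : MatSpace n p) :
    inner ℝ (mulCLM C V) U = inner ℝ (mulCLM C U) V := by
  rw [inner_mulCLM, inner_mulCLM, Finset.sum_comm]
  exact Finset.sum_congr rfl fun i _ => Finset.sum_congr rfl fun j _ => by
    rw [hC.apply, real_inner_comm]

theorem gradient_objective {C : Matrix (Fin n) (Fin n) ℝ} (hC : C.IsSymm) (V : MatSpace n p) :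
    gradient (objective C) V = (-2 : ℝ) • mulCLM C V := by
  rw [funext (objective_eq_neg_inner C)]
  exact (hasGradientAt_neg_inner_self (inner_mulCLM_comm hC) V).gradient

theorem riemGrad_objective {C : Matrix (Fin n) (Fin n) ℝ} (hC : C.IsSymm) (V : MatSpace n p) :
    riemGrad (objective C) V = tangentProj V ((-2 : ℝ) • mulCLM C V) := by
  rw [riemGrad, gradient_objective hC]

theorem fderiv_riemGrad_objective_apply {C : Matrix (Fin n) (Fin n) ℝ} (hC : C.IsSymm)
    (V U : MatSpace n p) (i : Fin n) :
    fderiv ℝ (riemGrad (objective C)) V U i =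
      (-2 : ℝ) • (mulCLM C U i - (inner ℝ (mulCLM C V i) (V i) • U i +
        (inner ℝ (mulCLM C V i) (U i) + inner ℝ (mulCLM C U i) (V i)) • V i)) := by
  let q : Fin n → MatSpace n p →L[ℝ] EuclideanSpace ℝ (Fin p) := fun i => PiLp.proj 2 _ i
  have hq : ∀ i Z, q i Z = Z i := fun i Z => rfl
  have hg : ∀ i Z, (q i ∘L mulCLM C) Z = mulCLM C Z i := fun i Z => rfl
  have hF : ∀ i, (fun V : MatSpace n p => riemGrad (objective C) V i) =
      fun V => (-2 : ℝ) • ((q i ∘L mulCLM C) V -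
        inner ℝ ((q i ∘L mulCLM C) V) (q i V) • q i V) := fun i => by
    funext V
    rw [riemGrad_objective hC, hg, hq]
    simp only [tangentProj, PiLp.smul_apply, inner_smul_left, RCLike.conj_to_real]
    module
  have hd : DifferentiableAt ℝ (riemGrad (objective C)) V := by
    refine differentiableAt_piLp 2 |>.2 fun i => ?_
    rw [hF]
    obtain ⟨D, hD, -⟩ := exists_hasFDerivAt_smul_sub_inner_smul (-2) (q i ∘L mulCLM C) (q i) V
    exact hD.differentiableAt
  obtain ⟨D, hD, hDU⟩ := exists_hasFDerivAt_smul_sub_inner_smul (-2) (q i ∘L mulCLM C) (q i) V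
  rw [← hF] at hD
  have h4 : fderiv ℝ (riemGrad (objective C)) V U i = D U := apply_fderiv_eq (q i) hd hD U
  rw [h4, hDU, hg, hg, hq, hq]

/-- Differentiating the extended gradient field also produces multiples of `V i`; these vanish when
paired with a tangent `U`, as does the correction from the outer projection. -/
theorem inner_riemHess_objective {C : Matrix (Fin n) (Fin n) ℝ} (hC : C.IsSymm)
    {V U : MatSpace n p} (hU : U ∈ tangentSpace V) :
    inner ℝ (riemHess (objective C) V U) U =
      2 * (∑ i, inner ℝ (mulCLM C V i) (V i) * ‖U i‖ ^ 2 -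
        ∑ i, ∑ j, C i j * inner ℝ (U i) (U j)) := by
  have hU' : ∀ i, inner ℝ (V i) (U i) = 0 := fun i => by rw [real_inner_comm]; exact hU i
  rw [PiLp.inner_apply, ← Finset.sum_sub_distrib, Finset.mul_sum]
  refine Finset.sum_congr rfl fun i _ => ?_
  have h1 : inner ℝ (mulCLM C U i) (U i) = ∑ j, C i j * inner ℝ (U i) (U j) := by
    simp [sum_inner, inner_smul_left, real_inner_comm]
  simp only [riemHess, tangentProj, fderiv_riemGrad_objective_apply hC, inner_sub_left,
    inner_smul_left, inner_add_left, hU', ← h1, real_inner_self_eq_norm_sq]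
  simp
  ring

theorem IsSOCP.isCritical {C : Matrix (Fin n) (Fin n) ℝ} (hC : C.IsSymm) {V : MatSpace n p}
    (h : IsSOCP C V) : IsCritical C (fun i => V i) fun i => inner ℝ (mulCLM C V i) (V i) where
  norm_eq_one := (mem_feasible_iff V).1 h.feasible
  first_order i := by
    have h1 := congrArg (fun Z : MatSpace n p => Z i) h.grad_eq_zero
    rw [riemGrad_objective hC] at h1
    have h2 : (-2 : ℝ) • (mulCLM C V i - inner ℝ (mulCLM C V i) (V i) • V i) = 0 := by
      refine Eq.trans ?_ h1
      simp only [tangentProj, PiLp.smul_apply, inner_smul_left, RCLike.conj_to_real]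
      module
    rw [mulCLM_apply] at h2 ⊢
    exact sub_eq_zero.1 ((smul_eq_zero.1 h2).resolve_left (by norm_num))
  second_order U hU := by
    have h1 := h.hess_nonneg (WithLp.toLp 2 U) hU
    rw [inner_riemHess_objective hC (U := WithLp.toLp 2 U) hU] at h1
    simp only at h1
    linarith

/-- Conjugating `C` by a diagonal matrix of signs. -/
def conjSigns (x : Fin n → ℝ) (C : Matrix (Fin n) (Fin n) ℝ) : Matrix (Fin n) (Fin n) ℝ :=
  Matrix.of fun i j => x i * x j * C i j

/-- Flipping rows by signs is an isometry of the product of spheres, so it preserves criticality and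
the multipliers. -/
theorem IsCritical.conjSigns {C : Matrix (Fin n) (Fin n) ℝ}
    {V : Fin n → EuclideanSpace ℝ (Fin p)} {Λ : Fin n → ℝ} (h : IsCritical C V Λ)
    {x : Fin n → ℝ} (hx : ∀ i, x i * x i = 1) :
    IsCritical (conjSigns x C) (fun i => x i • V i) Λ where
  norm_eq_one i := by
    have : |x i| = 1 := by
      have := abs_mul_self (x i)
      rw [abs_mul, hx] at this
      nlinarith [abs_nonneg (x i)]
    rw [norm_smul, h.norm_eq_one, Real.norm_eq_abs, this, mul_one]
  first_order i := by
    have h1 : ∀ j, BurerMonteiro.conjSigns x C i j • x j • V j = x i • C i j • V j := fun j => by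
      simp only [BurerMonteiro.conjSigns, Matrix.of_apply, smul_smul]
      congr 1
      linear_combination x i * C i j * hx j
    simp only [h1]
    rw [← Finset.smul_sum, h.first_order, smul_comm]
  second_order U hU := by
    have h1 := h.second_order (fun i => x i • U i) fun i => by
      have := hU i
      rw [inner_smul_right] at this
      rwa [inner_smul_left]
    refine (le_of_eq ?_).trans (h1.trans (le_of_eq ?_))
    · refine Finset.sum_congr rfl fun i _ => Finset.sum_congr rfl fun j _ => ?_
      simp [BurerMonteiro.conjSigns, inner_smul_left, inner_smul_right]
      ring
    · refine Finset.sum_congr rfl fun i _ => ?_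
      rw [norm_smul, mul_pow, Real.norm_eq_abs, sq_abs, sq, hx, one_mul]

theorem isOptimal_and_outer_eq {C : Matrix (Fin n) (Fin n) ℝ} (hC : C.IsSymm)
    (hC0 : ∀ i, C i i = 0) (hp : 2 ≤ p) (hn : n ≠ 0) {x : Fin n → ℝ} (hx : ∀ i, x i * x i = 1)
    {δ κ m : ℝ} (hδ : 0 < δ) (hκ : 0 < κ)
    (hW : OpBound (conjSigns x C - Matrix.of fun _ _ => δ) κ) (hκδ : 8 * κ ≤ δ * n)
    (hm : ∀ i, m ≤ ∑ j, conjSigns x C i j) (hκm : 8 * κ ^ 2 / (δ * n) + 2 * κ < m)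
    {V : MatSpace n p} (hV : IsSOCP C V) : IsOptimal C V ∧ outer V = Matrix.vecMulVec x x := by
  have hS : (conjSigns x C).IsSymm := Matrix.IsSymm.ext fun i j => by
    simp only [conjSigns, Matrix.of_apply, hC.apply i j, mul_comm]
  have hc := (hV.isCritical hC).conjSigns hx
  obtain ⟨u, hu⟩ := hc.exists_forall_eq hS (fun i => by simp [conjSigns, hC0]) hp hn hδ hκ hW
    hκδ hm hκm
  have hVu : ∀ i, V i = x i • u := fun i => by rw [← hu, smul_smul, hx, one_smul]
  have hu1 : ‖u‖ = 1 := by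
    rw [← hu ⟨0, Nat.pos_of_ne_zero hn⟩]
    exact hc.norm_eq_one _
  have hin : ∀ i j, inner ℝ (V i) (V j) = x i * x j := fun i j => by
    rw [hVu, hVu, inner_smul_left, inner_smul_right, real_inner_self_eq_norm_sq, hu1]
    simp
  refine ⟨⟨hV.feasible, fun U hU => ?_⟩, ?_⟩
  · have hU1 := (mem_feasible_iff U).1 hU
    have hκm' : κ ≤ m := by
      have : 0 ≤ 8 * κ ^ 2 / (δ * n) := by positivity
      linarith
    have h1 := sum_sum_mul_inner_le hS hn hκ hW hm hκm' (V := fun i => x i • U i) fun i => by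
      have hxi : ‖x i‖ = 1 := by
        have := norm_mul (x i) (x i)
        rw [hx, norm_one] at this
        nlinarith [norm_nonneg (x i)]
      rw [norm_smul, hU1, hxi, mul_one]
    have h2 : ∀ i j, conjSigns x C i j * inner ℝ (x i • U i) (x j • U j) =
        C i j * inner ℝ (U i) (U j) := fun i j => by
      simp only [conjSigns, Matrix.of_apply, inner_smul_left, inner_smul_right, RCLike.conj_to_real]
      linear_combination (C i j * inner ℝ (U i) (U j)) * (hx i * x j * x j + hx j)
    simp only [h2] at h1
    simp only [Set.mem_ofPred_eq, objective_eq, hin, neg_le_neg_iff]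
    refine h1.trans (le_of_eq (Finset.sum_congr rfl fun i _ => Finset.sum_congr rfl fun j _ => ?_))
    simp only [conjSigns, Matrix.of_apply]
    ring
  · ext i j
    rw [outer_apply, hin, Matrix.vecMulVec_apply]

end Calculus

/-! ### Operator norm from a net of the unit ball. -/

section Net

/-- Doubling gives a 1-separated set in the ball of radius 2, the setting of the Besicovitch
cardinality bound. -/
theorem card_le_five_pow_of_separated {n : ℕ} {s : Finset (EuclideanSpace ℝ (Fin n))}
    (hs : ∀ c ∈ s, ‖c‖ ≤ 1) (h : ∀ c ∈ s, ∀ d ∈ s, c ≠ d → 1 / 2 ≤ ‖c - d‖) :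
    s.card ≤ 5 ^ n := by
  classical
  have hinj : Function.Injective fun c : EuclideanSpace ℝ (Fin n) => (2 : ℝ) • c :=
    smul_right_injective _ two_ne_zero
  have h1 := Besicovitch.card_le_of_separated (s.image fun c => (2 : ℝ) • c)
    (by
      simp only [Finset.mem_image, forall_exists_index, and_imp, forall_apply_eq_imp_iff₂, norm_smul]
      intro c hc
      have := hs c hc
      norm_num
      linarith)
    (by
      simp only [Finset.mem_image, forall_exists_index, and_imp, forall_apply_eq_imp_iff₂,
        ← smul_sub, norm_smul]
      intro c hc d hd hcd
      have := h c hc d hd fun h => hcd (by rw [h])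
      norm_num
      linarith)
  rwa [Finset.card_image_of_injective _ hinj, finrank_euclideanSpace_fin] at h1

/-- A separated set of maximal cardinality is a net: an uncovered point could be added to it. -/
theorem exists_half_net (n : ℕ) : ∃ s : Finset (EuclideanSpace ℝ (Fin n)), s.card ≤ 5 ^ n ∧
    (∀ c ∈ s, ‖c‖ ≤ 1) ∧ ∀ a : EuclideanSpace ℝ (Fin n), ‖a‖ ≤ 1 → ∃ c ∈ s, ‖a - c‖ ≤ 1 / 2 := by
  classical
  let S : Set ℕ := {k | ∃ s : Finset (EuclideanSpace ℝ (Fin n)), ((∀ c ∈ s, ‖c‖ ≤ 1) ∧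
    ∀ c ∈ s, ∀ d ∈ s, c ≠ d → 1 / 2 ≤ ‖c - d‖) ∧ s.card = k}
  have hS : BddAbove S := ⟨5 ^ n, by
    rintro _ ⟨s, hs, rfl⟩
    exact card_le_five_pow_of_separated hs.1 hs.2⟩
  obtain ⟨s, ⟨hs1, hs2⟩, hs⟩ := Nat.sSup_mem (s := S) ⟨0, ∅, by simp, rfl⟩ hS
  refine ⟨s, card_le_five_pow_of_separated hs1 hs2, hs1, fun a ha => ?_⟩
  by_contra! hcon
  have has : a ∉ s := fun h => by
    have := hcon a h
    norm_num at this
  have h1 : s.card + 1 ∈ S := by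
    refine ⟨insert a s, ⟨?_, ?_⟩, Finset.card_insert_of_notMem has⟩
    · simpa [ha] using hs1
    · intro c hc d hd hcd
      rcases Finset.mem_insert.1 hc with rfl | hc' <;> rcases Finset.mem_insert.1 hd with rfl | hd'
      · exact absurd rfl hcd
      · exact (hcon d hd').le
      · rw [norm_sub_rev]
        exact (hcon c hc').le
      · exact hs2 c hc' d hd' hcd
  have := le_csSup hS h1
  omega

/-- Bounding the bilinear form on a `1/2`-net of the unit ball bounds the operator norm. -/
theorem norm_toEuclideanCLM_le_of_net {n : ℕ} {s : Finset (EuclideanSpace ℝ (Fin n))}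
    (hs : ∀ a : EuclideanSpace ℝ (Fin n), ‖a‖ ≤ 1 → ∃ c ∈ s, ‖a - c‖ ≤ 1 / 2)
    {W : Matrix (Fin n) (Fin n) ℝ} {t : ℝ} (ht : 0 ≤ t)
    (h : ∀ u ∈ s, ∀ v ∈ s, ∑ i, ∑ j, u i * v j * W i j ≤ t) :
    ‖Matrix.toEuclideanCLM (n := Fin n) (𝕜 := ℝ) W‖ ≤ 4 * t := by
  set T := Matrix.toEuclideanCLM (n := Fin n) (𝕜 := ℝ) W with hT
  have h1 : ∀ u ∈ s, ∀ v ∈ s, inner ℝ u (T v) ≤ t := fun u hu v hv => by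
    refine le_of_eq_of_le ?_ (h u hu v hv)
    rw [hT, Matrix.inner_toEuclideanCLM]
    simp only [dotProduct, Matrix.mulVec, Finset.mul_sum]
    exact Finset.sum_congr rfl fun i _ => Finset.sum_congr rfl fun j _ => by ring
  have h2 : ∀ v ∈ s, ‖T v‖ ≤ 2 * t := fun v hv => by
    rcases (norm_nonneg (T v)).eq_or_lt with h0 | h0
    · rw [← h0]; positivity
    set z := T v
    obtain ⟨c, hc, hcz⟩ := hs (‖z‖⁻¹ • z)
      (by rw [norm_smul, norm_inv, norm_norm, inv_mul_cancel₀ h0.ne'])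
    have e1 : inner ℝ c z = ‖z‖ - inner ℝ (‖z‖⁻¹ • z - c) z := by
      rw [inner_sub_left, inner_smul_left, real_inner_self_eq_norm_sq]
      simp only [RCLike.conj_to_real]
      field_simp
      ring
    have e2 := le_of_abs_le (abs_real_inner_le_norm (‖z‖⁻¹ • z - c) z)
    have e3 := mul_le_mul_of_nonneg_right hcz h0.le
    have e4 := h1 c hc v hv
    linarith
  -- Each of the two arguments loses a factor 2 in passing to the net, whence `4 * t`.
  have h3 : ‖T‖ ≤ 2 * t + ‖T‖ / 2 := by
    refine ContinuousLinearMap.opNorm_le_of_unit_norm (by positivity) fun a ha => ?_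
    obtain ⟨c, hc, hca⟩ := hs a ha.le
    have e1 : T a = T c + T (a - c) := by rw [← map_add, add_sub_cancel]
    rw [e1]
    refine (norm_add_le _ _).trans (add_le_add (h2 c hc) ?_)
    refine (T.le_opNorm _).trans ?_
    have := mul_le_mul_of_nonneg_left hca (norm_nonneg T)
    linarith
  linarith

theorem opBound_of_norm_toEuclideanCLM_le {n : ℕ} {W : Matrix (Fin n) (Fin n) ℝ} {κ : ℝ}
    (h : ‖Matrix.toEuclideanCLM (n := Fin n) (𝕜 := ℝ) W‖ ≤ κ) : OpBound W κ := fun a => by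
  have h1 := (Matrix.toEuclideanCLM (n := Fin n) (𝕜 := ℝ) W).le_of_opNorm_le h (WithLp.toLp 2 a)
  have h2 := pow_le_pow_left₀ (norm_nonneg _) h1 2
  rwa [mul_pow, EuclideanSpace.real_norm_sq_eq, EuclideanSpace.real_norm_sq_eq] at h2

end Net

/-! ### Concentration of the noise norm and of the row sums. -/

section Probability

variable {n : ℕ}

/-- The centred matrix `xxᵀ ∘ C - δ(J - I)`. -/
def noise (x : Fin n → ℝ) (δ : ℝ) (C : Matrix (Fin n) (Fin n) ℝ) : Matrix (Fin n) (Fin n) ℝ :=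
  conjSigns x C - Matrix.of (fun _ _ => δ) + δ • 1

theorem noise_apply_of_ne (x : Fin n → ℝ) (δ : ℝ) (C : Matrix (Fin n) (Fin n) ℝ) {i j : Fin n}
    (h : i ≠ j) : noise x δ C i j = x i * x j * C i j - δ := by
  simp [noise, conjSigns, h]

theorem sum_sum_eq_sum_lt (f : Fin n → Fin n → ℝ) :
    ∑ i, ∑ j, f i j = ∑ i, f i i +
      ∑ e : {e : Fin n × Fin n // e.1 < e.2}, (f e.1.1 e.1.2 + f e.1.2 e.1.1) := by
  have h1 : ∀ g : Fin n × Fin n → ℝ, ∑ e : {e : Fin n × Fin n // e.1 < e.2}, g e.1 =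
      ∑ i, ∑ j, if i < j then g (i, j) else 0 := fun g => by
    rw [← Finset.sum_product', Finset.univ_product_univ, ← Finset.sum_filter]
    exact (Finset.sum_subtype (p := fun e : Fin n × Fin n => e.1 < e.2) _ (by simp) g).symm
  rw [h1 fun e => f e.1 e.2 + f e.2 e.1]
  have h2 : ∀ i j, (if i < j then f i j + f j i else 0) =
      (if i < j then f i j else 0) + if i < j then f j i else 0 := fun i j => by
    split_ifs <;> simp
  simp only [h2, Finset.sum_add_distrib]
  rw [Finset.sum_comm (f := fun i j => if i < j then f j i else 0)]
  have h3 : ∀ i, f i i = ∑ j, if i = j then f i j else 0 := fun i => by simp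
  rw [Finset.sum_congr rfl fun i _ => h3 i]
  simp only [← Finset.sum_add_distrib]
  refine Finset.sum_congr rfl fun i _ => Finset.sum_congr rfl fun j _ => ?_
  rcases lt_trichotomy i j with h | h | h
  · simp [h, h.ne, h.not_gt]
  · simp [h]
  · simp [h, h.ne', h.not_gt]

theorem sum_lt_le_sum_sum {f : Fin n → Fin n → ℝ} (hf : ∀ i j, 0 ≤ f i j) :
    ∑ e : {e : Fin n × Fin n // e.1 < e.2}, (f e.1.1 e.1.2 + f e.1.2 e.1.1) ≤
      ∑ i, ∑ j, f i j := by
  rw [sum_sum_eq_sum_lt f]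
  have := Finset.sum_nonneg fun i (_ : i ∈ Finset.univ) => hf i i
  linarith

variable {Ω : Type*} [MeasurableSpace Ω] {μ : Measure Ω} {x : Fin n → ℝ} {δ : ℝ}
  {C : Ω → Matrix (Fin n) (Fin n) ℝ}

theorem _root_.ProbabilityTheory.HasSubgaussianMGF.mono {X : Ω → ℝ} {c d : NNReal}
    (h : HasSubgaussianMGF X c μ) (hcd : c ≤ d) : HasSubgaussianMGF X d μ where
  integrable_exp_mul := h.integrable_exp_mul
  mgf_le t := (h.mgf_le t).trans <| Real.exp_le_exp.2 <| by
    have : (c : ℝ) ≤ d := by exact_mod_cast hcd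
    gcongr

namespace IsBernoulliSync

theorem noise_diag (h : IsBernoulliSync μ x δ C) (ω : Ω) (i : Fin n) :
    noise x δ (C ω) i i = 0 := by
  simp [noise, conjSigns, h.diag]

theorem noise_symm (h : IsBernoulliSync μ x δ C) (ω : Ω) (i j : Fin n) :
    noise x δ (C ω) i j = noise x δ (C ω) j i := by
  by_cases hij : i = j
  · rw [hij]
  · rw [noise_apply_of_ne _ _ _ hij, noise_apply_of_ne _ _ _ (Ne.symm hij), (h.symm ω).apply,
      mul_comm (x i)]

variable [IsProbabilityMeasure μ]

/-- The signed entry is almost surely `±1` with mean `δ`; Hoeffding's lemma on an interval of length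
2 gives variance proxy 1. -/
theorem hasSubgaussianMGF (h : IsBernoulliSync μ x δ C) (hx : ∀ i, x i * x i = 1) (hδ0 : 0 ≤ δ)
    (hδ1 : δ ≤ 1) {i j : Fin n} (hij : i ≠ j) :
    HasSubgaussianMGF (fun ω => x i * x j * C ω i j - δ) 1 μ := by
  have hxx : (x i * x j) * (x i * x j) = 1 := by
    linear_combination (x j * x j) * hx i + hx j
  have hm := h.measurable i j
  set s := {ω | C ω i j = x i * x j}
  set t := {ω | C ω i j = -(x i * x j)}
  have hs : MeasurableSet s := hm (measurableSet_singleton _)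
  have ht : MeasurableSet t := hm (measurableSet_singleton _)
  have hst : Disjoint s t := Set.disjoint_left.2 fun ω (h1 : C ω i j = _) (h2 : C ω i j = _) => by
    nlinarith
  have hμ : μ (s ∪ t) = 1 := by
    rw [measure_union hst ht, h.prob_keep i j hij, h.prob_flip i j hij,
      ← ENNReal.ofReal_add (by linarith) (by linarith)]
    convert ENNReal.ofReal_one using 2
    ring
  have hae : ∀ᵐ ω ∂μ, ω ∈ s ∪ t := (mem_ae_iff_prob_eq_one (hs.union ht)).2 hμ
  have hval : ∀ᵐ ω ∂μ, x i * x j * C ω i j = s.indicator (fun _ => (2 : ℝ)) ω - 1 := by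
    filter_upwards [hae] with ω hω
    by_cases hω' : ω ∈ s
    · rw [Set.indicator_of_mem hω', show C ω i j = _ from hω', hxx]; norm_num
    · rw [Set.indicator_of_notMem hω', show C ω i j = _ from hω.resolve_left hω', mul_neg, hxx]
      norm_num
  have hint : ∫ ω, x i * x j * C ω i j ∂μ = δ := by
    rw [integral_congr_ae hval, integral_sub ((integrable_const _).indicator hs)
      (integrable_const _), integral_indicator_const _ hs, Measure.real, h.prob_keep i j hij,
      ENNReal.toReal_ofReal (by linarith)]
    simp
  have h1 := hasSubgaussianMGF_of_mem_Icc (μ := μ) (X := fun ω => x i * x j * C ω i j) (a := -1)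
    (b := 1) (hm.const_mul _).aemeasurable (by
      filter_upwards [hval] with ω hω
      rw [hω]
      by_cases hω' : ω ∈ s
      · rw [Set.indicator_of_mem hω']; norm_num
      · rw [Set.indicator_of_notMem hω']; norm_num)
  rw [hint] at h1
  convert h1 using 1
  ext
  norm_num

/-- Hoeffding's inequality for linear functionals of the noise matrix. -/
theorem measureReal_le_sum_noise_le (h : IsBernoulliSync μ x δ C) (hx : ∀ i, x i * x i = 1)
    (hδ0 : 0 ≤ δ) (hδ1 : δ ≤ 1) (B : Fin n → Fin n → ℝ) {v t : ℝ} (ht : 0 ≤ t)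
    (hB : ∑ e : {e : Fin n × Fin n // e.1 < e.2}, (B e.1.1 e.1.2 + B e.1.2 e.1.1) ^ 2 ≤ v) :
    μ.real {ω | t ≤ ∑ i, ∑ j, B i j * noise x δ (C ω) i j} ≤ Real.exp (-t ^ 2 / (2 * v)) := by
  have hv : 0 ≤ v := (Finset.sum_nonneg fun e _ => sq_nonneg _).trans hB
  let b : {e : Fin n × Fin n // e.1 < e.2} → ℝ := fun e => B e.1.1 e.1.2 + B e.1.2 e.1.1
  have hind := h.indep.comp (fun e c => b e * (x e.1.1 * x e.1.2 * c - δ)) fun e => by fun_prop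
  have hsub := HasSubgaussianMGF.sum_of_iIndepFun hind (s := Finset.univ) fun e _ =>
    (h.hasSubgaussianMGF hx hδ0 hδ1 e.2.ne).const_mul (b e)
  have hle := (hsub.mono (d := ⟨v, hv⟩) (by
    refine NNReal.coe_le_coe.1 ?_
    rw [NNReal.coe_sum]
    exact le_of_eq_of_le (Finset.sum_congr rfl fun e _ => mul_one _) hB)).measure_ge_le ht
  refine le_of_eq_of_le ?_ hle
  congr 1
  ext ω
  simp only [Set.mem_ofPred_eq, Function.comp]
  rw [sum_sum_eq_sum_lt]
  simp only [h.noise_diag, mul_zero, Finset.sum_const_zero, zero_add]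
  refine Eq.to_iff (congrArg _ (Finset.sum_congr rfl fun e _ => ?_))
  rw [h.noise_symm ω e.1.2, noise_apply_of_ne _ _ _ e.2.ne, ← add_mul]

theorem measureReal_norm_noise_le (h : IsBernoulliSync μ x δ C) (hx : ∀ i, x i * x i = 1)
    (hδ0 : 0 ≤ δ) (hδ1 : δ ≤ 1) :
    μ.real {ω | 16 * √n < ‖Matrix.toEuclideanCLM (n := Fin n) (𝕜 := ℝ) (noise x δ (C ω))‖} ≤
      25 ^ n * Real.exp (-(4 * n)) := by
  obtain ⟨s, hs, hs1, hsn⟩ := exists_half_net n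
  have hsub : {ω | 16 * √n < ‖Matrix.toEuclideanCLM (n := Fin n) (𝕜 := ℝ) (noise x δ (C ω))‖} ⊆
      ⋃ q ∈ s ×ˢ s, {ω | 4 * √n ≤ ∑ i, ∑ j, q.1 i * q.2 j * noise x δ (C ω) i j} := by
    intro ω hω
    by_contra hcon
    simp only [Set.mem_iUnion, Set.mem_ofPred_eq, Finset.mem_product, not_exists, not_le] at hcon
    have := norm_toEuclideanCLM_le_of_net hsn (W := noise x δ (C ω)) (t := 4 * √n) (by positivity)
      fun u hu v hv => (hcon (u, v) ⟨hu, hv⟩).le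
    rw [Set.mem_ofPred_eq] at hω
    linarith
  have hq : ∀ q ∈ s ×ˢ s, μ.real {ω | 4 * √n ≤ ∑ i, ∑ j, q.1 i * q.2 j * noise x δ (C ω) i j} ≤
      Real.exp (-(4 * n)) := fun q hq => by
    obtain ⟨hu, hv⟩ := Finset.mem_product.1 hq
    have hu1 : ∑ i, q.1 i ^ 2 ≤ 1 := by
      rw [← EuclideanSpace.real_norm_sq_eq]
      exact pow_le_one₀ (norm_nonneg _) (hs1 _ hu)
    have hv1 : ∑ i, q.2 i ^ 2 ≤ 1 := by
      rw [← EuclideanSpace.real_norm_sq_eq]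
      exact pow_le_one₀ (norm_nonneg _) (hs1 _ hv)
    -- The proxy is 2 since `(a + b)² ≤ 2a² + 2b²` and `u, v` lie in the unit ball; the exponent is
    -- `(4√n)²/(2·2) = 4n`.
    refine (h.measureReal_le_sum_noise_le hx hδ0 hδ1 (fun i j => q.1 i * q.2 j) (v := 2)
      (by positivity) ?_).trans (Real.exp_le_exp.2 ?_)
    · calc _ ≤ ∑ e : {e : Fin n × Fin n // e.1 < e.2}, (2 * (q.1 e.1.1 ^ 2 * q.2 e.1.2 ^ 2) +
            2 * (q.1 e.1.2 ^ 2 * q.2 e.1.1 ^ 2)) := Finset.sum_le_sum fun e _ => by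
            nlinarith [sq_nonneg (q.1 e.1.1 * q.2 e.1.2 - q.1 e.1.2 * q.2 e.1.1)]
        _ ≤ ∑ i, ∑ j, 2 * (q.1 i ^ 2 * q.2 j ^ 2) :=
            sum_lt_le_sum_sum (f := fun i j => 2 * (q.1 i ^ 2 * q.2 j ^ 2)) fun i j => by positivity
        _ = 2 * ((∑ i, q.1 i ^ 2) * ∑ j, q.2 j ^ 2) := by
            rw [Finset.sum_mul_sum]; simp only [Finset.mul_sum]
        _ ≤ 2 := by
            have := mul_le_one₀ hu1 (Finset.sum_nonneg fun j _ => sq_nonneg (q.2 j)) hv1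
            linarith
    · rw [mul_pow, Real.sq_sqrt (Nat.cast_nonneg n)]
      apply le_of_eq
      ring
  have hcard : ((s ×ˢ s).card : ℝ) ≤ 25 ^ n := by
    rw [Finset.card_product]
    have : s.card * s.card ≤ 5 ^ n * 5 ^ n := Nat.mul_le_mul hs hs
    rw [← mul_pow] at this
    exact_mod_cast this
  calc _ ≤ μ.real (⋃ q ∈ s ×ˢ s, _) := measureReal_mono hsub (measure_ne_top _ _)
    _ ≤ ∑ q ∈ s ×ˢ s, _ := measureReal_biUnion_finset_le _ _
    _ ≤ ∑ q ∈ s ×ˢ s, Real.exp (-(4 * n)) := Finset.sum_le_sum hq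
    _ = (s ×ˢ s).card * Real.exp (-(4 * n)) := by rw [Finset.sum_const, nsmul_eq_mul]
    _ ≤ _ := by gcongr

theorem measureReal_exists_degree_le (h : IsBernoulliSync μ x δ C) (hx : ∀ i, x i * x i = 1)
    (hδ0 : 0 ≤ δ) (hδ1 : δ ≤ 1) {t : ℝ} (ht : 0 ≤ t) :
    μ.real {ω | ∃ i, ∑ j, conjSigns x (C ω) i j ≤ δ * n - δ - t} ≤
      n * Real.exp (-t ^ 2 / (2 * n)) := by
  -- Minus the sum of row `i` turns a lower tail into an upper one. Each independent entry occurs at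
  -- most once, so the proxy is at most `n`.
  let B : Fin n → Fin n → Fin n → ℝ := fun i k _ => if k = i then -1 else 0
  have hsub : {ω | ∃ i, ∑ j, conjSigns x (C ω) i j ≤ δ * n - δ - t} ⊆
      ⋃ i ∈ Finset.univ, {ω | t ≤ ∑ k, ∑ j, B i k j * noise x δ (C ω) k j} := by
    rintro ω ⟨i, hi⟩
    simp only [Set.mem_iUnion, Set.mem_ofPred_eq]
    refine ⟨i, Finset.mem_univ i, ?_⟩
    have e1 : ∑ k, ∑ j, B i k j * noise x δ (C ω) k j = -∑ j, noise x δ (C ω) i j := by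
      rw [Finset.sum_eq_single i (fun k _ hk => by simp [B, hk]) (by simp)]
      simp [B]
    have e2 : ∑ j, noise x δ (C ω) i j = ∑ j, conjSigns x (C ω) i j - n * δ + δ := by
      simp [noise, Finset.sum_add_distrib, Matrix.one_apply]
    rw [e1, e2]
    linarith
  have hq : ∀ i ∈ Finset.univ, μ.real {ω | t ≤ ∑ k, ∑ j, B i k j * noise x δ (C ω) k j} ≤
      Real.exp (-t ^ 2 / (2 * n)) := fun i _ => by
    refine h.measureReal_le_sum_noise_le hx hδ0 hδ1 (B i) ht ?_
    calc _ = ∑ e : {e : Fin n × Fin n // e.1 < e.2}, ((if e.1.1 = i then (1 : ℝ) else 0) +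
            if e.1.2 = i then 1 else 0) := Finset.sum_congr rfl fun e _ => by
            by_cases h1 : e.1.1 = i
            · have h2 : e.1.2 ≠ i := fun h2 => e.2.ne (h1.trans h2.symm)
              simp [B, h1, h2]
            · by_cases h2 : e.1.2 = i <;> simp [B, h1, h2]
      _ ≤ ∑ k, ∑ j : Fin n, if k = i then (1 : ℝ) else 0 :=
            sum_lt_le_sum_sum (f := fun k _ => if k = i then (1 : ℝ) else 0) fun k j => by
              split_ifs <;> norm_num
      _ = n := by simp
  calc _ ≤ μ.real (⋃ i ∈ Finset.univ, _) := measureReal_mono hsub (measure_ne_top _ _)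
    _ ≤ ∑ i, _ := measureReal_biUnion_finset_le _ _
    _ ≤ ∑ i : Fin n, Real.exp (-t ^ 2 / (2 * n)) := Finset.sum_le_sum hq
    _ = _ := by rw [Finset.sum_const, nsmul_eq_mul, Finset.card_univ, Fintype.card_fin]

end IsBernoulliSync

end Probability

/-! ### Numerical estimates and the union of the two bad events. -/

theorem opBound_of_norm_noise_le {n : ℕ} {x : Fin n → ℝ} {δ κ : ℝ} (hδ : 0 ≤ δ)
    {C : Matrix (Fin n) (Fin n) ℝ}
    (h : ‖Matrix.toEuclideanCLM (n := Fin n) (𝕜 := ℝ) (noise x δ C)‖ ≤ κ) :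
    OpBound (conjSigns x C - Matrix.of fun _ _ => δ) (κ + δ) := by
  refine opBound_of_norm_toEuclideanCLM_le ?_
  have h1 : (conjSigns x C - Matrix.of fun _ _ => δ) = noise x δ C - δ • 1 := by
    rw [noise, add_sub_cancel_right]
  rw [h1, map_sub, map_smul, map_one]
  refine (norm_sub_le _ _).trans (add_le_add h ?_)
  rw [norm_smul, Real.norm_eq_abs, abs_of_nonneg hδ]
  exact mul_le_of_le_one_right hδ ContinuousLinearMap.norm_id_le

theorem one_sub_measureReal_sub_le {Ω : Type*} [MeasurableSpace Ω] {μ : Measure Ω}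
    [IsProbabilityMeasure μ] {s a b : Set Ω} (h : ∀ ω, ω ∉ a → ω ∉ b → ω ∈ s) :
    1 - μ.real a - μ.real b ≤ μ.real s := by
  have h1 : Set.univ ⊆ s ∪ (a ∪ b) := fun ω _ => by
    by_cases ha : ω ∈ a
    · exact Or.inr (Or.inl ha)
    by_cases hb : ω ∈ b
    · exact Or.inr (Or.inr hb)
    exact Or.inl (h ω ha hb)
  have h2 := measureReal_mono (μ := μ) h1
  have h3 := measureReal_union_le (μ := μ) s (a ∪ b)
  have h4 := measureReal_union_le (μ := μ) a b
  rw [probReal_univ] at h2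
  linarith

/-- Since `25 e⁻⁴ ≤ 1/2`, the net failure probability is at most `2⁻ⁿ`. -/
theorem pow_mul_exp_le_rpow {n : ℕ} (hn : 0 < n) (h : (n : ℝ) ^ 3 * (1 / 2) ^ n ≤ 1) :
    25 ^ n * Real.exp (-(4 * n)) ≤ (n : ℝ) ^ (-3 : ℝ) := by
  have hn' : (0 : ℝ) < n := by exact_mod_cast hn
  have h1 : 25 * Real.exp (-4) ≤ 1 / 2 := by
    have h2 : (50 : ℝ) ≤ Real.exp 4 := by
      have h3 : Real.exp 4 = Real.exp 1 ^ 4 := by rw [← Real.exp_nat_mul]; norm_num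
      rw [h3]
      have := pow_le_pow_left₀ (by norm_num) Real.exp_one_gt_d9.le 4
      norm_num at this ⊢
      linarith
    rw [Real.exp_neg, ← div_eq_mul_inv, div_le_iff₀ (Real.exp_pos _)]
    linarith
  have h4 : 25 ^ n * Real.exp (-(4 * n)) = (25 * Real.exp (-4)) ^ n := by
    rw [mul_pow, ← Real.exp_nat_mul]
    congr 2
    ring
  rw [h4, Real.rpow_neg hn'.le, show (3 : ℝ) = ((3 : ℕ) : ℝ) by norm_num, Real.rpow_natCast,
    le_inv_comm₀ (by positivity) (by positivity), ← one_div, le_div_iff₀ (by positivity)]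
  refine le_trans ?_ h
  gcongr

theorem eventually_large (a b : ℝ) : ∀ᶠ n : ℕ in Filter.atTop, a ≤ √(Real.log n) ∧
    b ≤ √(Real.log n) ∧ (n : ℝ) ^ 3 * (1 / 2) ^ n ≤ 1 ∧ 0 < n := by
  have h1 : Filter.Tendsto (fun n : ℕ => √(Real.log n)) Filter.atTop Filter.atTop :=
    Real.tendsto_sqrt_atTop.comp (Real.tendsto_log_atTop.comp tendsto_natCast_atTop_atTop)
  have h2 : Filter.Tendsto (fun n : ℕ => (n : ℝ) ^ 3 * (1 / 2) ^ n) Filter.atTop (nhds 0) :=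
    tendsto_pow_const_mul_const_pow_of_abs_lt_one 3 (by norm_num [abs_of_pos])
  filter_upwards [h1.eventually_ge_atTop a, h1.eventually_ge_atTop b,
    h2.eventually_le_const one_pos, Filter.eventually_gt_atTop 0] with n h3 h4 h5 h6
  exact ⟨h3, h4, h5, h6⟩

end BurerMonteiro

theorem corollary4 (ε : ℝ) (hε : 0 < ε) :
    ∃ N : ℕ, ∀ n : ℕ, N ≤ n → ∀ p : ℕ, 2 ≤ p →
      ∀ δ : ℝ, 0 < δ → δ ≤ 1 →
      ((p : ℝ) + 1) / ((p : ℝ) - 1) * Real.sqrt ((2 + ε) * Real.log n / n) < δ →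
      ∀ x : Fin n → ℝ, (∀ i, x i = 1 ∨ x i = -1) →
      ∀ (Ω : Type*) [MeasurableSpace Ω] (μ : Measure Ω) [IsProbabilityMeasure μ]
        (C : Ω → Matrix (Fin n) (Fin n) ℝ), BurerMonteiro.IsBernoulliSync μ x δ C →
      1 - (n : ℝ) ^ (-3 : ℝ) - (n : ℝ) ^ (-(ε / 3)) ≤
        μ.real {ω | ∀ V : BurerMonteiro.MatSpace n p, BurerMonteiro.IsSOCP (C ω) V →
          BurerMonteiro.IsOptimal (C ω) V ∧
            BurerMonteiro.outer V = Matrix.vecMulVec x x} := by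
  -- `r` is chosen so that `n · exp(-r² log n / 2) = n^(-ε/3)`. The remaining gap `√(2+ε) - r = 2c`
  -- is split: one `c` absorbs the diagonal correction `δ`, the other serves as `m`.
  set r := √(2 + 2 * ε / 3) with hr
  set c := (√(2 + ε) - r) / 2 with hc
  have hrε : r < √(2 + ε) := Real.sqrt_lt_sqrt (by positivity) (by linarith)
  have hc0 : 0 < c := by rw [hc]; linarith
  -- With `κ ≤ 17√n`: `136 = 8·17` handles `8κ ≤ δn`, and `2347` exceeds `8·17² + 2·17 = 2346`,
  -- which handles the gap condition.
  obtain ⟨N, hN⟩ := Filter.eventually_atTop.1 (BurerMonteiro.eventually_large 136 (2347 / c))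
  refine ⟨N, fun n hn p hp δ hδ0 hδ1 hδ x hx Ω _ μ _ C hC => ?_⟩
  obtain ⟨hL, hLc, hpow, hn0⟩ := hN n hn
  set L := √(Real.log n) with hLdef
  set R := √(n : ℝ) with hRdef
  have hn' : (1 : ℝ) ≤ n := by exact_mod_cast hn0
  have hR1 : 1 ≤ R := Real.one_le_sqrt.2 hn'
  have hR2 : R ^ 2 = n := Real.sq_sqrt (by linarith)
  have hlog : 0 ≤ Real.log n := Real.log_nonneg hn'
  have hL2 : L ^ 2 = Real.log n := Real.sq_sqrt hlog
  have hcL : 2347 ≤ c * L := by rwa [div_le_iff₀' hc0] at hLc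
  have hx1 : ∀ i, x i * x i = 1 := fun i => by rcases hx i with h | h <;> rw [h] <;> norm_num
  have hδn : √(2 + ε) * (R * L) ≤ δ * n := by
    have h1 : √((2 + ε) * Real.log n / n) ≤ δ := by
      refine le_trans ?_ hδ.le
      have hp' : (2 : ℝ) ≤ p := by exact_mod_cast hp
      refine le_mul_of_one_le_left (Real.sqrt_nonneg _) ?_
      rw [le_div_iff₀ (by linarith)]
      linarith
    rw [Real.sqrt_div (by positivity), Real.sqrt_mul (by positivity), div_le_iff₀ (by positivity)]
      at h1
    calc √(2 + ε) * (R * L) = (√(2 + ε) * L) * R := by ring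
      _ ≤ (δ * R) * R := by gcongr
      _ = δ * n := by rw [← hR2]; ring
  have hRL : R * L ≤ δ * n := by
    refine le_trans (le_mul_of_one_le_left (by positivity) ?_) hδn
    exact Real.one_le_sqrt.2 (by linarith)
  have hκδ : 8 * (16 * R + δ) ≤ δ * n := by nlinarith
  have hκm : 8 * (16 * R + δ) ^ 2 / (δ * n) + 2 * (16 * R + δ) < c * (R * L) := by
    have h1 : 8 * (16 * R + δ) ^ 2 / (δ * n) ≤ 2312 * R := by
      rw [div_le_iff₀ (by positivity)]
      have h2 : (16 * R + δ) ^ 2 ≤ (17 * R) ^ 2 := by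
        gcongr
        linarith
      have h3 : R * R ≤ R * (δ * n) := by
        gcongr
        nlinarith
      nlinarith
    nlinarith
  have hprob1 := hC.measureReal_norm_noise_le hx1 hδ0.le hδ1
  have hprob2 := hC.measureReal_exists_degree_le hx1 hδ0.le hδ1 (t := r * (R * L)) (by positivity)
  have hexp : n * Real.exp (-(r * (R * L)) ^ 2 / (2 * n)) = (n : ℝ) ^ (-(ε / 3)) := by
    have h1 : -(r * (R * L)) ^ 2 / (2 * n) = -Real.log n + Real.log n * (-(ε / 3)) := by
      rw [mul_pow, mul_pow, hR2, hL2, hr, Real.sq_sqrt (by positivity)]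
      field_simp
      ring
    rw [h1, Real.exp_add, Real.exp_neg, Real.exp_log (by linarith),
      ← Real.rpow_def_of_pos (by linarith), mul_inv_cancel_left₀ (by linarith)]
  rw [hexp] at hprob2
  have hprob1' := hprob1.trans (BurerMonteiro.pow_mul_exp_le_rpow hn0 hpow)
  refine (sub_le_sub (sub_le_sub_left hprob1' 1) hprob2).trans
    (BurerMonteiro.one_sub_measureReal_sub_le fun ω h1 h2 V hV => ?_)
  simp only [Set.mem_ofPred_eq, not_lt, not_exists, not_le] at h1 h2
  refine BurerMonteiro.isOptimal_and_outer_eq (hC.symm ω) (hC.diag ω) hp hn0.ne' hx1 hδ0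
    (by positivity) (BurerMonteiro.opBound_of_norm_noise_le hδ0.le h1) hκδ (fun i => ?_) hκm hV
  refine le_trans ?_ (h2 i).le
  have h3 : √(2 + ε) * (R * L) = 2 * (c * (R * L)) + r * (R * L) := by rw [hc]; ring
  have h4 : 1 ≤ c * (R * L) := by nlinarith
  linarith
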